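/- Let $b>0$. For $\nu\in\mathbb{C}$ let $y_{\mathrm{even}}(\nu,\cdot)$ and $y_{\mathrm{odd}}(\nu,\cdot)$ be the solutions of Weber's equation $-y''(x)+\left(\frac{x^2}{4}-\frac12\right)y(x)=\nu y(x)$ given by $$y_{\mathrm{even}}(\nu,x)=e^{-x^2/4}\Big[1+(-\nu)\frac{x^2}{2!}+(-\nu)(-\nu+2)\frac{x^4}{4!}+\cdots\Big],\qquad y_{\mathrm{odd}}(\nu,x)=e^{-x^2/4}\Big[x+(-\nu+1)\frac{x^3}{3!}+(-\nu+1)(-\nu+3)\frac{x^5}{5!}+\cdots\Big],$$ and let $$D_\nu(x)=\frac{2^{\nu/2}\sqrt{\pi}}{\Gamma\left(-\frac{\nu}{2}+\frac12\right)}\,y_{\mathrm{even}}(\nu,x)-\frac{2^{(\nu+1)/2}\sqrt{\pi}}{\Gamma\left(-\frac{\nu}{2}\right)}\,y_{\mathrm{odd}}(\nu,x)$$ be the parabolic cylinder function, where $1/\Gamma$ denotes the entire reciprocal Gamma function. For $\nu\in\mathbb{C}\setminus\{0,1,2,\dots\}$ put $$M(\nu)=\sqrt{\tfrac{2}{\pi}}\;\Gamma(-\nu)\,D_\nu(b)^2\,y_{\mathrm{even}}(\nu,b)\,y_{\mathrm{odd}}(\nu,b).$$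 (i) If $\lambda\in\mathbb{C}$ and $D_\lambda(b)=0$, then $\lambda$ is real and $\lambda>0$. (ii) If $\lambda\in\mathbb{R}$ is not a positive integer and $D_\lambda(b)=0$, then $\lambda$ is a simple zero of the holomorphic function $\nu\mapsto D_\nu(b)$. (iii) If $\lambda\in\mathbb{R}$ is not a positive integer and $D_\lambda(b)=0$, then $M$ is holomorphic near $\lambda$, and in its local expansion $$M(\nu)=c_2(\nu-\lambda)^2+O\big((\nu-\lambda)^3\big),\qquad \nu\to\lambda,\ \nu\in\mathbb{C},$$ the coefficient $c_2$ is real and $c_2>0$. -/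

import Mathlib

open scoped Topology
open Asymptotics

namespace Weber

/-- The power-series coefficient `(-ν)(-ν+2)⋯(-ν+2k-2) / (2k)!` of `x ^ (2k)`. -/
noncomputable def evenCoeff (ν : ℂ) (k : ℕ) : ℂ :=
  (∏ j ∈ Finset.range k, (-ν + 2 * (j : ℂ))) / ((2 * k).factorial : ℂ)

/-- The power-series coefficient `(-ν+1)(-ν+3)⋯(-ν+2k-1) / (2k+1)!` of `x ^ (2k+1)`. -/
noncomputable def oddCoeff (ν : ℂ) (k : ℕ) : ℂ :=
  (∏ j ∈ Finset.range k, (-ν + 1 + 2 * (j : ℂ))) / ((2 * k + 1).factorial : ℂ)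

/-- The even solution of Weber's equation `-y'' + (x²/4 - 1/2) y = ν y`, with
`y(0) = 1`, `y'(0) = 0`:
`exp(-x²/4) [1 + (-ν) x²/2! + (-ν)(-ν+2) x⁴/4! + ⋯]`. -/
noncomputable def yEven (ν x : ℂ) : ℂ :=
  Complex.exp (-x ^ 2 / 4) * ∑' k : ℕ, evenCoeff ν k * x ^ (2 * k)

/-- The odd solution of Weber's equation `-y'' + (x²/4 - 1/2) y = ν y`, with
`y(0) = 0`, `y'(0) = 1`:
`exp(-x²/4) [x + (-ν+1) x³/3! + (-ν+1)(-ν+3) x⁵/5! + ⋯]`. -/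
noncomputable def yOdd (ν x : ℂ) : ℂ :=
  Complex.exp (-x ^ 2 / 4) * ∑' k : ℕ, oddCoeff ν k * x ^ (2 * k + 1)

/-- The value `D_ν(0) = 2^(ν/2) √π / Γ((1-ν)/2)`. At the poles of `Γ`, Mathlib's `Gamma` is `0`
and so is its inverse, so `(Gamma s)⁻¹` is the entire function `1/Γ(s)`. -/
noncomputable def dValue (ν : ℂ) : ℂ :=
  (2 : ℂ) ^ (ν / 2) * (Real.sqrt Real.pi : ℂ) * (Complex.Gamma (-ν / 2 + 1 / 2))⁻¹

/-- The derivative `(d/dx) D_ν(x)` at `x = 0`, that is `-2^((ν+1)/2) √π / Γ(-ν/2)`. -/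
noncomputable def dSlope (ν : ℂ) : ℂ :=
  -((2 : ℂ) ^ ((ν + 1) / 2) * (Real.sqrt Real.pi : ℂ) * (Complex.Gamma (-ν / 2))⁻¹)

/-- The parabolic cylinder function `D_ν(x)`: the solution of Weber's equation whose value and
derivative at `0` are `dValue ν` and `dSlope ν`. -/
noncomputable def parabolicD (ν x : ℂ) : ℂ :=
  dValue ν * yEven ν x + dSlope ν * yOdd ν x

/-- `M(ν; b) = √(2/π) Γ(-ν) D_ν(b)² y_even(ν, b) y_odd(ν, b)`, meromorphic in `ν`, with poles at
most at the non-negative integers (where the value in Lean is meaningless). -/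
noncomputable def eigM (b : ℝ) (ν : ℂ) : ℂ :=
  (Real.sqrt (2 / Real.pi) : ℂ) * Complex.Gamma (-ν) * parabolicD ν (b : ℂ) ^ 2
    * yEven ν (b : ℂ) * yOdd ν (b : ℂ)

/-- Ratio-test helper for the two series below. -/
theorem summable_coeff_aux (a : ℂ) (c : ℕ → ℕ) (hc : ∀ k, 0 < c k) (hc2 : ∀ k, (k+1)*(k+1) * c k ≤ c (k+1)) (x : ℂ) (e:ℕ) :
   Summable fun k : ℕ => (∏ j ∈ Finset.range k, (a + 2 * (j : ℂ))) / (c k : ℂ) * x ^ (2 * k + e) := by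
  have hlim : Filter.Tendsto (fun k : ℕ => (‖a‖ + 2) * ‖x‖^2 * (1 / ((k:ℝ)+1))) Filter.atTop (𝓝 ((‖a‖ + 2) * ‖x‖^2 * 0)) :=
    tendsto_one_div_add_atTop_nhds_zero_nat.const_mul _
  rw [mul_zero] at hlim
  refine summable_of_ratio_norm_eventually_le (r := 1/2) (by norm_num) ?_
  filter_upwards [hlim.eventually_le_const (show (0:ℝ) < 1/2 by norm_num)] with k hk
  have h1 : ‖a + 2 * (k:ℂ)‖ ≤ (‖a‖ + 2) * ((k:ℝ)+1) := by
    refine (norm_add_le _ _).trans ?_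
    simp only [norm_mul, Complex.norm_natCast, Complex.norm_ofNat]
    nlinarith [norm_nonneg a, (Nat.cast_nonneg k : (0:ℝ) ≤ k), mul_nonneg (norm_nonneg a) (Nat.cast_nonneg k : (0:ℝ) ≤ k)]
  have hk0 : (0:ℝ) < (k:ℝ)+1 := by positivity
  have hcp : (0:ℝ) < c k := by exact_mod_cast hc k
  have h2 : ((k:ℝ)+1)*((k:ℝ)+1) * c k ≤ c (k+1) := by exact_mod_cast hc2 k
  rw [Finset.prod_range_succ]
  simp only [norm_mul, norm_div, norm_pow, Complex.norm_natCast]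
  set P := ‖∏ j ∈ Finset.range k, (a + 2 * (j : ℂ))‖
  calc P * ‖a + 2 * (k:ℂ)‖ / (c (k+1) : ℝ) * ‖x‖ ^ (2*(k+1)+e)
      ≤ P * ((‖a‖ + 2) * ((k:ℝ)+1)) / (((k:ℝ)+1)*((k:ℝ)+1) * c k) * ‖x‖ ^ (2*(k+1)+e) := by
        gcongr
    _ = ((‖a‖ + 2) * ‖x‖^2 * (1 / ((k:ℝ)+1))) * (P / c k * ‖x‖ ^ (2*k+e)) := by
        field_simp
        ring
    _ ≤ 1/2 * (P / c k * ‖x‖ ^ (2*k+e)) := by gcongr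

/-- The series in `yEven` converges everywhere. -/
theorem summable_evenCoeff (ν x : ℂ) : Summable fun k : ℕ => evenCoeff ν k * x ^ (2 * k) := by
  refine summable_coeff_aux (-ν) (fun k => (2 * k).factorial) (fun k => Nat.factorial_pos _)
    (fun k => ?_) x 0
  rw [show 2 * (k + 1) = 2 * k + 1 + 1 by ring, Nat.factorial_succ, Nat.factorial_succ,
    ← mul_assoc]
  gcongr <;> omega

/-- The series in `yOdd` converges everywhere. -/
theorem summable_oddCoeff (ν x : ℂ) : Summable fun k : ℕ => oddCoeff ν k * x ^ (2 * k + 1) := by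
  refine summable_coeff_aux (-ν + 1) (fun k => (2 * k + 1).factorial)
    (fun k => Nat.factorial_pos _) (fun k => ?_) x 1
  rw [show 2 * (k + 1) + 1 = 2 * k + 1 + 1 + 1 by ring, Nat.factorial_succ (2 * k + 1 + 1),
    Nat.factorial_succ (2 * k + 1), ← mul_assoc]
  gcongr <;> omega

end Weber

/-! ### Power series, ladder relations and the Wronskian of the even and odd solutions -/

namespace Weber

/-! Weber's equation is used only through the ladder relations D_ν' = -(x/2) D_ν + ν D_{ν-1} = (x/2)
D_ν - D_{ν+1}. As D_ν decays at +∞, integration by parts over (b, ∞) gives μ ∫ D_{μ-1} D_ν - ∫ D_μ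
D_{ν+1} = -D_μ(b) D_ν(b) (`mul_pairing_sub_pairing`).

At a zero λ, the choice of conj λ and λ - 1 kills the boundary term: conj λ · ‖D_{λ-1}‖² = ‖D_λ‖².
By the Wronskian, D_λ and its derivative have no common zero, so λ D_{λ-1}(b) ≠ 0. Hence λ ≠ 0 and
‖D_{λ-1}‖ > 0, which forces λ to be real and positive.

Antisymmetrising the same identity gives (λ - ν) ∫ D_λ D_ν = -D_{λ+1}(b) D_ν(b). Dividing by λ - ν
and letting ν → λ shows that D_{λ+1}(b) ∂_ν D_ν(b) = ‖D_λ‖² > 0 at ν = λ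
(`parabolicD_add_one_mul_deriv`), so the zero is simple, with real derivative d.

Finally c₂ is d² times √(2/π) Γ(-λ) y_even y_odd. The equation D_λ(b) = 0 makes y_even(b)
proportional to y_odd(b), and the duplication formula turns the product into a positive constant
times a real square (`Gamma_mul_yEven_mul_yOdd`), nonzero by the Wronskian.

The decay comes from a Laplace integral for Re ν < 0 and the three-term recurrence in ν
(`eventually_norm_parabolicD_le`). -/

theorem evenCoeff_succ_mul (ν : ℂ) (k : ℕ) :
    evenCoeff ν (k + 1) * (2 * k + 2 : ℕ) = -ν * oddCoeff (ν - 1) k := by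
  have h : ((2 * k + 1).factorial : ℂ) ≠ 0 := Nat.cast_ne_zero.2 (Nat.factorial_ne_zero _)
  have h2 : ((2 * k + 2 : ℕ) : ℂ) ≠ 0 := Nat.cast_ne_zero.2 (Nat.succ_ne_zero _)
  rw [evenCoeff, oddCoeff, Finset.prod_range_succ',
    show 2 * (k + 1) = (2 * k + 1) + 1 by ring, Nat.factorial_succ,
    Finset.prod_congr rfl (g := fun j : ℕ => -(ν - 1) + 1 + 2 * (j : ℂ))
      fun j _ => by push_cast; ring]
  rw [Nat.cast_mul]
  field_simp
  push_cast
  ring1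

theorem oddCoeff_mul (ν : ℂ) (k : ℕ) :
    oddCoeff ν k * (2 * k + 1 : ℕ) = evenCoeff (ν - 1) k := by
  have h : ((2 * k).factorial : ℂ) ≠ 0 := Nat.cast_ne_zero.2 (Nat.factorial_ne_zero _)
  have h2 : ((2 * k + 1 : ℕ) : ℂ) ≠ 0 := Nat.cast_ne_zero.2 (Nat.succ_ne_zero _)
  rw [evenCoeff, oddCoeff, Nat.factorial_succ,
    Finset.prod_congr rfl (g := fun j : ℕ => -(ν - 1) + 2 * (j : ℂ)) fun j _ => by ring,
    Nat.cast_mul]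
  field_simp

/-- The two even products share all but one factor, -ν against -ν + 2k + 2; the difference 2k + 2
lowers (2k+2)! to (2k+1)!. -/
theorem evenCoeff_succ_eq (ν : ℂ) (k : ℕ) :
    evenCoeff ν (k + 1) = evenCoeff (ν - 2) (k + 1) - oddCoeff (ν - 1) k := by
  have h : ((2 * k + 1).factorial : ℂ) ≠ 0 := Nat.cast_ne_zero.2 (Nat.factorial_ne_zero _)
  have h2 : ((2 * k + 1 + 1 : ℕ) : ℂ) ≠ 0 := Nat.cast_ne_zero.2 (Nat.succ_ne_zero _)
  rw [evenCoeff, evenCoeff, oddCoeff, Finset.prod_range_succ',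
    Finset.prod_range_succ (fun j : ℕ => -(ν - 2) + 2 * (j : ℂ)),
    show 2 * (k + 1) = (2 * k + 1) + 1 by ring, Nat.factorial_succ,
    Finset.prod_congr rfl (g := fun j : ℕ => -(ν - 1) + 1 + 2 * (j : ℂ))
      fun j _ => by push_cast; ring,
    Finset.prod_congr (f := fun j : ℕ => -(ν - 2) + 2 * (j : ℂ)) rfl
      (g := fun j : ℕ => -(ν - 1) + 1 + 2 * (j : ℂ)) fun j _ => by ring, Nat.cast_mul]
  field_simp
  push_cast
  ring

/-- All three terms are multiples of one product, since ν - 1 supplies the missing first factor up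
to sign; what remains is ν = (2k + 1) - (-ν + 1 + 2k). -/
theorem mul_oddCoeff_eq (ν : ℂ) (k : ℕ) :
    ν * oddCoeff ν k = evenCoeff (ν - 1) k + (ν - 1) * oddCoeff (ν - 2) k := by
  have h : ((2 * k).factorial : ℂ) ≠ 0 := Nat.cast_ne_zero.2 (Nat.factorial_ne_zero _)
  have h2 : ((2 * k + 1 : ℕ) : ℂ) ≠ 0 := Nat.cast_ne_zero.2 (Nat.succ_ne_zero _)
  have key : (ν - 1) * ∏ j ∈ Finset.range k, (-(ν - 2) + 1 + 2 * (j : ℂ)) =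
      -((∏ j ∈ Finset.range k, (-ν + 1 + 2 * (j : ℂ))) * (-ν + 1 + 2 * k)) := by
    rw [← Finset.prod_range_succ (fun j : ℕ => -ν + 1 + 2 * (j : ℂ)), Finset.prod_range_succ',
      Finset.prod_congr rfl (g := fun j : ℕ => -ν + 1 + 2 * ((j + 1 : ℕ) : ℂ))
        fun j _ => by push_cast; ring]
    push_cast
    ring
  rw [evenCoeff, oddCoeff, oddCoeff, ← mul_div_assoc, ← mul_div_assoc, key, Nat.factorial_succ,
    Finset.prod_congr rfl (g := fun j : ℕ => -ν + 1 + 2 * (j : ℂ)) (fun j _ => by ring),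
    Nat.cast_mul]
  field_simp
  push_cast
  ring_nf

/-- The power series in `yEven`. -/
noncomputable def evenSeries (ν x : ℂ) : ℂ := ∑' k : ℕ, evenCoeff ν k * x ^ (2 * k)

/-- The power series in `yOdd`. -/
noncomputable def oddSeries (ν x : ℂ) : ℂ := ∑' k : ℕ, oddCoeff ν k * x ^ (2 * k + 1)

@[simp] theorem evenCoeff_zero (ν : ℂ) : evenCoeff ν 0 = 1 := by simp [evenCoeff]

theorem evenSeries_eq_one_add (ν x : ℂ) :
    evenSeries ν x = 1 + ∑' k : ℕ, evenCoeff ν (k + 1) * x ^ (2 * (k + 1)) := by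
  rw [evenSeries, (summable_evenCoeff ν x).tsum_eq_zero_add]
  simp

@[simp] theorem evenSeries_zero (ν : ℂ) : evenSeries ν 0 = 1 := by
  rw [evenSeries_eq_one_add]
  simp

@[simp] theorem oddSeries_zero (ν : ℂ) : oddSeries ν 0 = 0 := by
  simp [oddSeries]

theorem evenSeries_sub_mul_oddSeries (ν x : ℂ) :
    evenSeries ν x = evenSeries (ν - 2) x - x * oddSeries (ν - 1) x := by
  have h := (summable_nat_add_iff 1).2 (summable_evenCoeff (ν - 2) x)
  rw [evenSeries_eq_one_add, evenSeries_eq_one_add (ν - 2), oddSeries, ← tsum_mul_left,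
    add_sub_assoc, ← h.tsum_sub ((summable_oddCoeff (ν - 1) x).mul_left x)]
  congr 1
  refine tsum_congr fun k => ?_
  rw [evenCoeff_succ_eq]
  ring

theorem mul_oddSeries_eq (ν x : ℂ) :
    ν * oddSeries ν x = x * evenSeries (ν - 1) x + (ν - 1) * oddSeries (ν - 2) x := by
  rw [oddSeries, oddSeries, evenSeries, ← tsum_mul_left, ← tsum_mul_left, ← tsum_mul_left,
    ← ((summable_evenCoeff (ν - 1) x).mul_left x).tsum_add
      ((summable_oddCoeff (ν - 2) x).mul_left _)]
  refine tsum_congr fun k => ?_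
  rw [← mul_assoc, mul_oddCoeff_eq]
  ring

/-- Termwise differentiation of a series of monomials. -/
theorem hasDerivAt_tsum_mul_pow {a b : ℕ → ℂ} {m n : ℕ → ℕ} (x : ℂ)
    (hd : ∀ k y, HasDerivAt (fun y : ℂ => a k * y ^ m k) (b k * y ^ n k) y)
    (ha : ∀ y : ℂ, Summable fun k => a k * y ^ m k)
    (hb : ∀ y : ℂ, Summable fun k => b k * y ^ n k) :
    HasDerivAt (fun y => ∑' k, a k * y ^ m k) (∑' k, b k * x ^ n k) x := by
  have hx : x ∈ Metric.ball (0 : ℂ) (‖x‖ + 1) := by simp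
  -- On the ball of radius ‖x‖ + 1 the differentiated series is dominated by its absolutely
  -- convergent values at that radius.
  refine hasDerivAt_tsum_of_isPreconnected
    (u := fun k => ‖b k * ((‖x‖ + 1 : ℝ) : ℂ) ^ n k‖) (hb _).norm Metric.isOpen_ball
    (convex_ball (0 : ℂ) (‖x‖ + 1)).isPreconnected (fun k y _ => hd k y) (fun k y hy => ?_) hx
    (ha x) hx
  rw [norm_mul, norm_mul, norm_pow, norm_pow]
  gcongr
  rw [mem_ball_zero_iff] at hy
  refine hy.le.trans ?_
  rw [Complex.norm_real]
  exact le_abs_self _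

theorem hasDerivAt_oddSeries (ν x : ℂ) :
    HasDerivAt (oddSeries ν) (evenSeries (ν - 1) x) x := by
  refine hasDerivAt_tsum_mul_pow (a := oddCoeff ν) (b := evenCoeff (ν - 1))
    (m := fun k => 2 * k + 1) (n := fun k => 2 * k) x (fun k y => ?_)
    (summable_oddCoeff ν) (summable_evenCoeff (ν - 1))
  refine ((hasDerivAt_pow (2 * k + 1) y).const_mul (oddCoeff ν k)).congr_deriv ?_
  rw [← oddCoeff_mul]
  simp only [Nat.add_sub_cancel]
  ring

theorem hasDerivAt_evenSeries (ν x : ℂ) :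
    HasDerivAt (evenSeries ν) (-ν * oddSeries (ν - 1) x) x := by
  have h := hasDerivAt_tsum_mul_pow (a := fun k => evenCoeff ν (k + 1))
    (b := fun k => -ν * oddCoeff (ν - 1) k)
    (m := fun k => 2 * (k + 1)) (n := fun k => 2 * k + 1) x (fun k y => ?_)
    (fun y => (summable_nat_add_iff (f := fun k => evenCoeff ν k * y ^ (2 * k)) 1).2
      (summable_evenCoeff ν y))
    (fun y => by simpa only [mul_assoc] using (summable_oddCoeff (ν - 1) y).mul_left (-ν))
  · rw [show evenSeries ν = fun y => 1 + ∑' k : ℕ, evenCoeff ν (k + 1) * y ^ (2 * (k + 1)) from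
      funext (evenSeries_eq_one_add ν), oddSeries, ← tsum_mul_left]
    simpa only [mul_assoc] using h.const_add 1
  · rw [show 2 * (k + 1) = 2 * k + 1 + 1 by ring, ← evenCoeff_succ_mul, mul_assoc]
    exact (hasDerivAt_pow (2 * k + 1 + 1) y).const_mul (evenCoeff ν (k + 1))

theorem hasDerivAt_gauss (x : ℂ) :
    HasDerivAt (fun x : ℂ => Complex.exp (-x ^ 2 / 4)) (-(x / 2) * Complex.exp (-x ^ 2 / 4)) x := by
  refine (((hasDerivAt_pow 2 x).fun_neg).div_const 4).cexp.congr_deriv ?_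
  push_cast
  ring

theorem yEven_eq (ν x : ℂ) : yEven ν x = Complex.exp (-x ^ 2 / 4) * evenSeries ν x := rfl

theorem yOdd_eq (ν x : ℂ) : yOdd ν x = Complex.exp (-x ^ 2 / 4) * oddSeries ν x := rfl

theorem hasDerivAt_yEven (ν x : ℂ) :
    HasDerivAt (yEven ν) (-(x / 2) * yEven ν x - ν * yOdd (ν - 1) x) x := by
  refine ((hasDerivAt_gauss x).mul (hasDerivAt_evenSeries ν x)).congr_deriv ?_
  simp only [yEven_eq, yOdd_eq]
  ring

theorem hasDerivAt_yOdd (ν x : ℂ) :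
    HasDerivAt (yOdd ν) (-(x / 2) * yOdd ν x + yEven (ν - 1) x) x := by
  refine ((hasDerivAt_gauss x).mul (hasDerivAt_oddSeries ν x)).congr_deriv ?_
  simp only [yEven_eq, yOdd_eq]
  ring

theorem yEven_eq_sub (ν x : ℂ) : yEven ν x = yEven (ν - 2) x - x * yOdd (ν - 1) x := by
  simp only [yEven_eq, yOdd_eq, evenSeries_sub_mul_oddSeries ν]
  ring

theorem mul_yOdd_eq (ν x : ℂ) :
    ν * yOdd ν x = x * yEven (ν - 1) x + (ν - 1) * yOdd (ν - 2) x := by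
  simp only [yEven_eq, yOdd_eq]
  linear_combination Complex.exp (-x ^ 2 / 4) * mul_oddSeries_eq ν x

@[simp] theorem yEven_zero (ν : ℂ) : yEven ν 0 = 1 := by simp [yEven_eq]

@[simp] theorem yOdd_zero (ν : ℂ) : yOdd ν 0 = 0 := by simp [yOdd_eq]

/-- The Wronskian of `yEven ν` and `yOdd ν` is `1`. -/
theorem wronskian_yEven_yOdd (ν x : ℂ) :
    yEven ν x * yEven (ν - 1) x + ν * yOdd (ν - 1) x * yOdd ν x = 1 := by
  -- The expression is y_even y_odd' - y_even' y_odd with the derivatives replaced by the ladder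
  -- relations; the x/2 terms cancel.
  have hd : ∀ z : ℂ, HasDerivAt
      (fun z => yEven ν z * yEven (ν - 1) z + ν * yOdd (ν - 1) z * yOdd ν z) 0 z := fun z => by
    refine (((hasDerivAt_yEven ν z).mul (hasDerivAt_yEven (ν - 1) z)).add
      (((hasDerivAt_yOdd (ν - 1) z).const_mul ν).mul (hasDerivAt_yOdd ν z))).congr_deriv ?_
    have h1 := yEven_eq_sub ν z
    have h2 := mul_yOdd_eq ν z
    rw [show ν - 1 - 1 = ν - 2 by ring]
    linear_combination (-ν * yOdd ν z) * h1 + yEven ν z * h2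
  have := is_const_of_deriv_eq_zero (fun z => (hd z).differentiableAt) (fun z => (hd z).deriv) x 0
  simpa using this

theorem yOdd_ne_zero_of_yEven_eq_zero (ν x : ℂ) (h : yEven ν x = 0) : yOdd ν x ≠ 0 := fun h' => by
  simpa [h, h'] using wronskian_yEven_yOdd ν x

/-! ### Ladder relations for D_ν -/

/-- This is Γ(s + 1) = s Γ(s) at s = -ν/2. Together with `dSlope_sub_one` it makes the normalisation
of D_ν compatible with shifts of ν. -/
theorem dSlope_eq (ν : ℂ) : dSlope ν = ν * dValue (ν - 1) := by
  have h := Complex.one_div_Gamma_eq_self_mul_one_div_Gamma_add_one (-ν / 2)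
  have h2 : (2 : ℂ) ^ ((ν + 1) / 2) = 2 ^ ((ν - 1) / 2) * 2 := by
    rw [show (ν + 1) / 2 = (ν - 1) / 2 + 1 by ring, Complex.cpow_add _ _ two_ne_zero,
      Complex.cpow_one]
  rw [dSlope, dValue, h, h2, show -(ν - 1) / 2 + 1 / 2 = -ν / 2 + 1 by ring]
  ring

theorem dSlope_sub_one (ν : ℂ) : dSlope (ν - 1) = -dValue ν := by
  rw [dSlope, dValue, show ν - 1 + 1 = ν by ring, show -(ν - 1) / 2 = -ν / 2 + 1 / 2 by ring]

theorem hasDerivAt_parabolicD (ν x : ℂ) :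
    HasDerivAt (parabolicD ν) (-(x / 2) * parabolicD ν x + ν * parabolicD (ν - 1) x) x := by
  refine (((hasDerivAt_yEven ν x).const_mul (dValue ν)).add
    ((hasDerivAt_yOdd ν x).const_mul (dSlope ν))).congr_deriv ?_
  rw [parabolicD, parabolicD, dSlope_sub_one, dSlope_eq ν]
  ring

theorem parabolicD_eq (ν x : ℂ) :
    parabolicD ν x = x * parabolicD (ν - 1) x - (ν - 1) * parabolicD (ν - 2) x := by
  have h1 := yEven_eq_sub ν x
  have h2 := mul_yOdd_eq ν x
  have h3 := dSlope_sub_one (ν - 1)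
  have h4 := dSlope_eq (ν - 1)
  rw [show ν - 1 - 1 = ν - 2 by ring] at h3 h4
  simp only [parabolicD]
  rw [dSlope_eq ν, h3]
  have h5 := dSlope_sub_one ν
  linear_combination dValue ν * h1 + dValue (ν - 1) * h2 - x * yOdd (ν - 1) x * h5 +
    yEven (ν - 2) x * h5 - yEven (ν - 2) x * h4

theorem hasDerivAt_parabolicD' (ν x : ℂ) :
    HasDerivAt (parabolicD ν) (x / 2 * parabolicD ν x - parabolicD (ν + 1) x) x := by
  refine (hasDerivAt_parabolicD ν x).congr_deriv ?_
  have := parabolicD_eq (ν + 1) x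
  rw [show ν + 1 - 1 = ν by ring, show ν + 1 - 2 = ν - 1 by ring] at this
  linear_combination this

theorem dSlope_ne_zero_of_dValue_eq_zero (ν : ℂ) (h : dValue ν = 0) : dSlope ν ≠ 0 := by
  intro h'
  have hpi : (Real.sqrt Real.pi : ℂ) ≠ 0 := by
    exact_mod_cast (Real.sqrt_pos.2 Real.pi_pos).ne'
  simp only [dValue, dSlope, neg_eq_zero, mul_eq_zero, Complex.cpow_eq_zero_iff, inv_eq_zero,
    OfNat.ofNat_ne_zero, false_and, hpi, or_false, false_or, Complex.Gamma_eq_zero_iff] at h h'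
  obtain ⟨m, hm⟩ := h
  obtain ⟨n, hn⟩ := h'
  -- Both reciprocal Gammas vanish only if ν is an odd and an even integer at once.
  have : (2 * m + 1 : ℂ) = 2 * n := by linear_combination 2 * hm - 2 * hn
  have : 2 * m + 1 = 2 * n := by exact_mod_cast this
  omega

/-- `D_ν` and its derivative have no common zero. -/
theorem mul_parabolicD_sub_one_ne_zero (ν x : ℂ) (h : parabolicD ν x = 0) :
    ν * parabolicD (ν - 1) x ≠ 0 := by
  intro h'
  have hW := wronskian_yEven_yOdd ν x
  have h2 : -dValue ν * (ν * yOdd (ν - 1) x) + dSlope ν * yEven (ν - 1) x = 0 := by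
    rw [parabolicD, dSlope_sub_one] at h'
    rw [dSlope_eq ν]
    linear_combination h'
  rw [parabolicD] at h
  -- `h` and `h2` form a homogeneous linear system in `dValue ν` and `dSlope ν` whose determinant
  -- is, up to sign, the Wronskian 1.
  have ha : dValue ν = 0 := by
    linear_combination -dValue ν * hW + yEven (ν - 1) x * h - yOdd ν x * h2
  have hs : dSlope ν = 0 := by
    linear_combination -dSlope ν * hW + ν * yOdd (ν - 1) x * h + yEven ν x * h2
  exact dSlope_ne_zero_of_dValue_eq_zero ν ha hs

end Weber

/-! ### Holomorphy in ν and conjugation symmetry -/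

namespace Weber

/-- On the disc of radius R each factor is largest at -R, where it is a nonnegative real. The series
at -R thus majorises the series uniformly on the disc. -/
theorem norm_prod_le {ν : ℂ} {R : ℝ} (hR : 0 ≤ R) (hν : ‖ν‖ ≤ R) (c : ℝ) (hc : 0 ≤ c) (k : ℕ) :
    ‖∏ j ∈ Finset.range k, (-ν + c + 2 * (j : ℂ))‖ ≤
      ‖∏ j ∈ Finset.range k, (-(-R : ℂ) + c + 2 * (j : ℂ))‖ := by
  rw [norm_prod, norm_prod]
  refine Finset.prod_le_prod (fun _ _ => norm_nonneg _) fun j _ => ?_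
  have h : (-(-R : ℂ) + c + 2 * (j : ℂ)) = ((R + c + 2 * j : ℝ) : ℂ) := by push_cast; ring
  rw [h, Complex.norm_real, Real.norm_of_nonneg (by positivity)]
  refine (norm_add_le _ _).trans (add_le_add ((norm_add_le _ _).trans ?_) (by simp))
  rw [norm_neg, Complex.norm_real, Real.norm_of_nonneg hc]
  gcongr

theorem norm_evenCoeff_le {ν : ℂ} {R : ℝ} (hR : 0 ≤ R) (hν : ‖ν‖ ≤ R) (k : ℕ) :
    ‖evenCoeff ν k‖ ≤ ‖evenCoeff (-R) k‖ := by
  have := norm_prod_le hR hν 0 le_rfl k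
  simp only [Complex.ofReal_zero, add_zero] at this
  rw [evenCoeff, evenCoeff, norm_div, norm_div]
  gcongr

theorem norm_oddCoeff_le {ν : ℂ} {R : ℝ} (hR : 0 ≤ R) (hν : ‖ν‖ ≤ R) (k : ℕ) :
    ‖oddCoeff ν k‖ ≤ ‖oddCoeff (-R) k‖ := by
  have := norm_prod_le hR hν 1 zero_le_one k
  simp only [Complex.ofReal_one] at this
  rw [oddCoeff, oddCoeff, norm_div, norm_div]
  gcongr

theorem differentiable_tsum_coeff {a : ℂ → ℕ → ℂ} {m : ℕ → ℕ} (x : ℂ)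
    (hd : ∀ k, Differentiable ℂ fun ν => a ν k)
    (hle : ∀ (ν : ℂ) (R : ℝ), 0 ≤ R → ‖ν‖ ≤ R → ∀ k, ‖a ν k‖ ≤ ‖a (-R) k‖)
    (hs : ∀ ν, Summable fun k => a ν k * x ^ m k) :
    Differentiable ℂ fun ν => ∑' k, a ν k * x ^ m k := fun ν => by
  refine (Complex.differentiableOn_tsum_of_summable_norm
    (hs (-((‖ν‖ + 1 : ℝ) : ℂ))).norm (U := Metric.ball 0 (‖ν‖ + 1))
    (fun k => ((hd k).mul_const _).differentiableOn) Metric.isOpen_ball fun k w hw => ?_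
    ).differentiableAt (Metric.isOpen_ball.mem_nhds (by simp))
  rw [norm_mul, norm_mul]
  gcongr
  exact hle w _ (by positivity) (mem_ball_zero_iff.1 hw).le k

theorem differentiable_yEven (x : ℂ) : Differentiable ℂ fun ν => yEven ν x := by
  refine Differentiable.const_mul (differentiable_tsum_coeff (a := evenCoeff)
    (m := fun k => 2 * k) x (fun k => ?_)
    (fun _ _ hR h => norm_evenCoeff_le hR h) fun ν => summable_evenCoeff ν x) _
  unfold evenCoeff
  fun_prop

theorem differentiable_yOdd (x : ℂ) : Differentiable ℂ fun ν => yOdd ν x := by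
  refine Differentiable.const_mul (differentiable_tsum_coeff (a := oddCoeff)
    (m := fun k => 2 * k + 1) x (fun k => ?_)
    (fun _ _ hR h => norm_oddCoeff_le hR h) fun ν => summable_oddCoeff ν x) _
  unfold oddCoeff
  fun_prop

theorem differentiable_two_cpow : Differentiable ℂ fun ν : ℂ => (2 : ℂ) ^ ν :=
  differentiable_id.const_cpow (Or.inl two_ne_zero)

theorem differentiable_dValue : Differentiable ℂ dValue :=
  ((differentiable_two_cpow.comp (differentiable_id.div_const 2)).mul_const _).mul
    (Complex.differentiable_one_div_Gamma.comp
      ((differentiable_id.neg.div_const 2).add_const _))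

theorem differentiable_dSlope : Differentiable ℂ dSlope :=
  (((differentiable_two_cpow.comp ((differentiable_id.add_const 1).div_const 2)).mul_const _).mul
    (Complex.differentiable_one_div_Gamma.comp (differentiable_id.neg.div_const 2))).neg

theorem differentiable_parabolicD (x : ℂ) : Differentiable ℂ fun ν => parabolicD ν x :=
  (differentiable_dValue.mul (differentiable_yEven x)).add
    (differentiable_dSlope.mul (differentiable_yOdd x))

open ComplexConjugate

theorem conj_two : conj (2 : ℂ) = 2 := map_ofNat _ 2

theorem conj_four : conj (4 : ℂ) = 4 := map_ofNat _ 4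

theorem conj_yEven (ν x : ℂ) : conj (yEven ν x) = yEven (conj ν) (conj x) := by
  rw [yEven, yEven, map_mul, Complex.conj_tsum, ← Complex.exp_conj]
  simp [evenCoeff, conj_two, conj_four]

theorem conj_yOdd (ν x : ℂ) : conj (yOdd ν x) = yOdd (conj ν) (conj x) := by
  rw [yOdd, yOdd, map_mul, Complex.conj_tsum, ← Complex.exp_conj]
  simp [oddCoeff, conj_two, conj_four]

theorem conj_two_cpow (ν : ℂ) : conj ((2 : ℂ) ^ ν) = 2 ^ conj ν := by
  rw [Complex.cpow_conj _ _ (by simpa using Real.pi_pos.ne)]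
  rw [conj_two]

theorem conj_dValue (ν : ℂ) : conj (dValue ν) = dValue (conj ν) := by
  simp [dValue, conj_two, conj_two_cpow, ← Complex.Gamma_conj]

theorem conj_dSlope (ν : ℂ) : conj (dSlope ν) = dSlope (conj ν) := by
  simp [dSlope, conj_two, conj_two_cpow, ← Complex.Gamma_conj]

theorem conj_parabolicD (ν x : ℂ) : conj (parabolicD ν x) = parabolicD (conj ν) (conj x) := by
  simp [parabolicD, conj_yEven, conj_yOdd, conj_dValue, conj_dSlope]

theorem ofReal_re_parabolicD (l x : ℝ) : ((parabolicD l x).re : ℂ) = parabolicD l x := by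
  rw [← Complex.conj_eq_iff_re, conj_parabolicD, Complex.conj_ofReal, Complex.conj_ofReal]

theorem ofReal_re_yOdd (l x : ℝ) : ((yOdd l x).re : ℂ) = yOdd l x := by
  rw [← Complex.conj_eq_iff_re, conj_yOdd, Complex.conj_ofReal, Complex.conj_ofReal]

end Weber

/-! ### Laplace integral for D_ν and decay at infinity -/

namespace Weber

open MeasureTheory Set

/-- Complex moments of the Gaussian `exp (-t² / 2)` on the half-line. -/
theorem integral_cpow_mul_gauss {s : ℂ} (hs : 0 < s.re) :
    ∫ t : ℝ in Ioi 0, (t : ℂ) ^ (s - 1) * (Real.exp (-(1 / 2) * t ^ 2) : ℂ) =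
      2 ^ (s / 2 - 1) * Complex.Gamma (s / 2) := by
  -- Substituting u = t² and then rescaling u by 1/2 reduces the moment to the Mellin transform of
  -- exp(-u).
  have h1 := mellin_comp_rpow (fun u : ℝ => (Real.exp (-(1 / 2 * u)) : ℂ)) s 2
  have h2 := mellin_comp_mul_left (fun u : ℝ => (Real.exp (-u) : ℂ)) (s / 2)
    (a := 1 / 2) (by norm_num)
  have h3 : Complex.Gamma (s / 2) = mellin (fun x => (Real.exp (-x) : ℂ)) (s / 2) := by
    rw [← Complex.GammaIntegral_eq_mellin, Complex.Gamma_eq_integral]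
    simpa using hs
  have h4 : ((1 / 2 : ℝ) : ℂ) ^ (-(s / 2)) = 2 ^ (s / 2) := by
    rw [Complex.cpow_neg, ← Complex.inv_cpow]
    · norm_num
    · rw [Complex.arg_ofReal_of_nonneg (by norm_num)]
      exact Real.pi_pos.ne
  have h5 : (2 : ℂ) ^ (s / 2 - 1) = 2⁻¹ * 2 ^ (s / 2) := by
    rw [Complex.cpow_sub _ _ two_ne_zero, Complex.cpow_one]
    ring
  have h6 : (fun t : ℝ => (Real.exp (-(1 / 2 * t ^ (2 : ℝ))) : ℂ)) =
      fun t : ℝ => (Real.exp (-(1 / 2) * t ^ 2) : ℂ) := by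
    funext t
    rw [Real.rpow_two, neg_mul]
  rw [h6, show ((2 : ℝ) : ℂ) = 2 by norm_num, h2, h4, ← h3] at h1
  rw [h5, mul_assoc]
  simpa [mellin] using h1

/-- Converts the Gamma factors of the Gaussian moments into the products in `evenCoeff` and
`oddCoeff`. -/
theorem Gamma_half_add_natCast {s : ℂ} (hs : 0 < s.re) (k : ℕ) :
    Complex.Gamma (s / 2 + k) * 2 ^ k =
      Complex.Gamma (s / 2) * ∏ j ∈ Finset.range k, (s + 2 * (j : ℂ)) := by
  induction k with
  | zero => simp
  | succ k ih =>
    have h0 : s / 2 + k ≠ 0 := fun h => by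
      have := congrArg Complex.re h
      simp at this
      have hk : (0 : ℝ) ≤ k := k.cast_nonneg
      linarith
    rw [Finset.prod_range_succ, ← mul_assoc, ← ih, Nat.cast_succ, ← add_assoc,
      Complex.Gamma_add_one _ h0]
    ring

theorem integrableOn_laplace_gauss {σ : ℝ} (hσ : 0 < σ) (c : ℝ) :
    IntegrableOn (fun t : ℝ => t ^ (σ - 1) * Real.exp (-(1 / 2) * t ^ 2) * Real.exp (c * t))
      (Ioi 0) := by
  have h := (integrableOn_rpow_mul_exp_neg_mul_sq (b := 1 / 4) (by norm_num)
    (s := σ - 1) (by linarith)).mul_const (Real.exp (c ^ 2))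
  refine Integrable.mono' h ?_ ?_
  · exact Measurable.aestronglyMeasurable (by fun_prop)
  · refine (ae_restrict_iff' measurableSet_Ioi).2 (Filter.Eventually.of_forall fun t ht => ?_)
    have ht : (0 : ℝ) < t := ht
    rw [Real.norm_of_nonneg (by positivity), mul_assoc, mul_assoc, ← Real.exp_add, ← Real.exp_add]
    refine mul_le_mul_of_nonneg_left (Real.exp_le_exp.2 ?_) (by positivity)
    -- Half of the Gaussian absorbs the exponential: ct ≤ t²/4 + c².
    nlinarith [sq_nonneg (c - t / 2)]

theorem norm_cpow_mul_gauss (s : ℂ) {t : ℝ} (ht : 0 < t) :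
    ‖(t : ℂ) ^ (s - 1) * (Real.exp (-(1 / 2) * t ^ 2) : ℂ)‖ =
      t ^ (s.re - 1) * Real.exp (-(1 / 2) * t ^ 2) := by
  rw [norm_mul, Complex.norm_cpow_eq_rpow_re_of_pos ht, Complex.norm_real,
    Real.norm_of_nonneg (Real.exp_pos _).le]
  simp

theorem measurable_cpow_mul_gauss (s : ℂ) :
    Measurable fun t : ℝ => (t : ℂ) ^ (s - 1) * (Real.exp (-(1 / 2) * t ^ 2) : ℂ) := by
  fun_prop

/-- Expansion of the Laplace transform of `t ^ (s - 1) * exp (-t² / 2)` in powers of `x`. -/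
theorem hasSum_laplace_gauss {s : ℂ} (hs : 0 < s.re) (x : ℝ) :
    HasSum (fun n : ℕ => (-x : ℂ) ^ n / n.factorial *
        (2 ^ ((s + n) / 2 - 1) * Complex.Gamma ((s + n) / 2)))
      (∫ t : ℝ in Ioi 0, (t : ℂ) ^ (s - 1) * (Real.exp (-(1 / 2) * t ^ 2) : ℂ) *
        Complex.exp (-x * t)) := by
  have key := hasSum_integral_of_dominated_convergence (μ := volume.restrict (Ioi (0 : ℝ)))
    (F := fun (n : ℕ) (t : ℝ) => (t : ℂ) ^ (s - 1) * (Real.exp (-(1 / 2) * t ^ 2) : ℂ) *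
      ((-x * t : ℂ) ^ n / n.factorial))
    (f := fun t : ℝ => (t : ℂ) ^ (s - 1) * (Real.exp (-(1 / 2) * t ^ 2) : ℂ) *
        Complex.exp (-x * t))
    (fun (n : ℕ) (t : ℝ) => t ^ (s.re - 1) * Real.exp (-(1 / 2) * t ^ 2) *
      ((|x| * t) ^ n / n.factorial)) ?_ ?_ ?_ ?_ ?_
  · refine key.congr_fun fun n => ?_
    rw [← integral_cpow_mul_gauss (s := s + n) (by simp; positivity), ← integral_const_mul]
    refine setIntegral_congr_fun measurableSet_Ioi fun t ht => ?_
    have ht : (t : ℂ) ≠ 0 := Complex.ofReal_ne_zero.2 (ne_of_gt ht)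
    rw [show s + n - 1 = s - 1 + n by ring, Complex.cpow_add _ _ ht, Complex.cpow_natCast, mul_pow]
    ring
  · intro n
    exact ((measurable_cpow_mul_gauss s).mul (by fun_prop)).aestronglyMeasurable
  · intro n
    refine (ae_restrict_iff' measurableSet_Ioi).2 (Filter.Eventually.of_forall fun t ht => ?_)
    have ht : (0 : ℝ) < t := ht
    rw [norm_mul, norm_cpow_mul_gauss s ht, norm_div, norm_pow, norm_mul, norm_neg,
      Complex.norm_real, Complex.norm_real, Real.norm_of_nonneg ht.le, Complex.norm_natCast,
      Real.norm_eq_abs]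
  · exact Filter.Eventually.of_forall fun t => (Real.summable_pow_div_factorial _).mul_left _
  · refine (integrableOn_laplace_gauss hs |x|).congr (Filter.Eventually.of_forall fun t => ?_)
    dsimp only
    rw [tsum_mul_left, Real.exp_eq_exp_ℝ, NormedSpace.exp_eq_tsum_div]
  · refine Filter.Eventually.of_forall fun t => HasSum.mul_left _ ?_
    rw [Complex.exp_eq_exp_ℂ]
    exact NormedSpace.expSeries_div_hasSum_exp _

/-- By the duplication formula, the normalising constant is the Gaussian moment of order -ν - 1, the
n = 0 term of the Laplace expansion; `Gamma_mul_dSlope` treats n = 1. -/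
theorem Gamma_mul_dValue {ν : ℂ} (hν : ν.re < 0) :
    Complex.Gamma (-ν) * dValue ν = 2 ^ (-ν / 2 - 1) * Complex.Gamma (-ν / 2) := by
  have hd := Complex.Gamma_mul_Gamma_add_half (-ν / 2)
  have h0 : Complex.Gamma (-ν / 2 + 1 / 2) ≠ 0 := Complex.Gamma_ne_zero_of_re_pos (by
    simp
    linarith)
  rw [show 2 * (-ν / 2) = -ν by ring] at hd
  have hp : (2 : ℂ) ^ (ν / 2) = 2 ^ (-ν / 2 - 1) * 2 ^ (1 - -ν) := by
    rw [← Complex.cpow_add _ _ two_ne_zero]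
    congr 1
    ring
  rw [dValue, hp, ← mul_assoc, mul_inv_eq_iff_eq_mul₀ h0]
  linear_combination -2 ^ (-ν / 2 - 1) * hd

theorem Gamma_mul_dSlope {ν : ℂ} (hν : ν.re < 0) :
    Complex.Gamma (-ν) * dSlope ν =
      -(2 ^ ((-ν + 1) / 2 - 1) * Complex.Gamma ((-ν + 1) / 2)) := by
  have hd := Complex.Gamma_mul_Gamma_add_half (-ν / 2)
  have h0 : Complex.Gamma (-ν / 2) ≠ 0 := Complex.Gamma_ne_zero_of_re_pos (by simpa)
  rw [show 2 * (-ν / 2) = -ν by ring] at hd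
  have hp : (2 : ℂ) ^ ((ν + 1) / 2) = 2 ^ ((-ν + 1) / 2 - 1) * 2 ^ (1 - -ν) := by
    rw [← Complex.cpow_add _ _ two_ne_zero]
    congr 1
    ring
  rw [dSlope, hp, mul_neg, neg_inj, ← mul_assoc, mul_inv_eq_iff_eq_mul₀ h0,
    show (-ν + 1) / 2 = -ν / 2 + 1 / 2 by ring]
  linear_combination -2 ^ (-ν / 2 + 1 / 2 - 1) * hd

/-- The integral representation of `D_ν` for `Re ν < 0`. -/
theorem Gamma_mul_parabolicD {ν : ℂ} (hν : ν.re < 0) (x : ℝ) :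
    Complex.Gamma (-ν) * parabolicD ν x = Complex.exp (-x ^ 2 / 4) *
      ∫ t : ℝ in Ioi 0, (t : ℂ) ^ (-ν - 1) * (Real.exp (-(1 / 2) * t ^ 2) : ℂ) *
        Complex.exp (-x * t) := by
  have hs : 0 < (-ν).re := by simpa
  have hs' : 0 < (-ν + 1).re := by simp; linarith
  have h1 := hasSum_laplace_gauss hs x
  -- The even powers of x rebuild the series of `yEven`, the odd ones that of `yOdd`.
  have h2 : HasSum _ _ := HasSum.even_add_odd (f := fun n : ℕ => (-x : ℂ) ^ n / n.factorial *
        (2 ^ ((-ν + n) / 2 - 1) * Complex.Gamma ((-ν + n) / 2)))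
    (((summable_evenCoeff ν x).hasSum.mul_left (2 ^ (-ν / 2 - 1) * Complex.Gamma (-ν / 2))
      ).congr_fun fun k => ?_)
    (((summable_oddCoeff ν x).hasSum.mul_left
      (-(2 ^ ((-ν + 1) / 2 - 1) * Complex.Gamma ((-ν + 1) / 2)))).congr_fun fun k => ?_)
  · rw [h1.unique h2, ← Gamma_mul_dValue hν, ← Gamma_mul_dSlope hν, parabolicD, yEven, yOdd]
    ring
  · have hG := Gamma_half_add_natCast hs k
    have hp : (2 : ℂ) ^ ((-ν + (2 * k : ℕ)) / 2 - 1) = 2 ^ (-ν / 2 - 1) * 2 ^ k := by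
      rw [← Complex.cpow_natCast, ← Complex.cpow_add _ _ two_ne_zero]
      congr 1
      push_cast
      ring
    rw [hp, show (-ν + (2 * k : ℕ)) / 2 = -ν / 2 + k by push_cast; ring, evenCoeff,
      Even.neg_pow (even_two_mul k)]
    linear_combination 2 ^ (-ν / 2 - 1) * (x : ℂ) ^ (2 * k) / ((2 * k).factorial : ℂ) * hG
  · have hG := Gamma_half_add_natCast hs' k
    have hp : (2 : ℂ) ^ ((-ν + (2 * k + 1 : ℕ)) / 2 - 1) = 2 ^ ((-ν + 1) / 2 - 1) * 2 ^ k := by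
      rw [← Complex.cpow_natCast, ← Complex.cpow_add _ _ two_ne_zero]
      congr 1
      push_cast
      ring
    rw [hp, show (-ν + (2 * k + 1 : ℕ)) / 2 = (-ν + 1) / 2 + k by push_cast; ring, oddCoeff,
      Odd.neg_pow (odd_two_mul_add_one k)]
    linear_combination
      -2 ^ ((-ν + 1) / 2 - 1) * (x : ℂ) ^ (2 * k + 1) / ((2 * k + 1).factorial : ℂ) * hG

/-- For x ≥ 0 the factor exp(-xt) is at most 1, so the Laplace integral is bounded by a Gaussian
moment independent of x. -/
theorem norm_parabolicD_le {ν : ℂ} (hν : ν.re < 0) {x : ℝ} (hx : 0 ≤ x) :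
    ‖parabolicD ν x‖ ≤ ‖(Complex.Gamma (-ν))⁻¹‖ *
      ((1 / 2) ^ (ν.re / 2) * (1 / 2) * Real.Gamma (-ν.re / 2)) * Real.exp (-(1 / 4) * x ^ 2) := by
  have hs : 0 < (-ν).re := by simpa
  have h0 : Complex.Gamma (-ν) ≠ 0 := Complex.Gamma_ne_zero_of_re_pos hs
  have h := Gamma_mul_parabolicD hν x
  rw [← eq_inv_mul_iff_mul_eq₀ h0] at h
  have hK := integral_rpow_mul_exp_neg_mul_rpow (p := 2) (q := -ν.re - 1) (b := 1 / 2)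
    (by norm_num) (by linarith) (by norm_num)
  rw [show -(-ν.re - 1 + 1) / 2 = ν.re / 2 by ring, show (-ν.re - 1 + 1) / 2 = -ν.re / 2 by ring]
    at hK
  have he : ‖Complex.exp (-x ^ 2 / 4)‖ = Real.exp (-(1 / 4) * x ^ 2) := by
    rw [show (-x ^ 2 / 4 : ℂ) = ((-(1 / 4) * x ^ 2 : ℝ) : ℂ) by push_cast; ring,
      ← Complex.ofReal_exp, Complex.norm_real, Real.norm_of_nonneg (Real.exp_pos _).le]
  rw [h, norm_mul, norm_mul, he, mul_assoc, mul_comm (Real.exp _), ← hK]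
  gcongr
  refine norm_integral_le_of_norm_le ?_
    ((ae_restrict_iff' measurableSet_Ioi).2 (Filter.Eventually.of_forall fun t ht => ?_))
  · have := integrableOn_laplace_gauss hs 0
    simpa [IntegrableOn] using this
  · have ht : (0 : ℝ) < t := ht
    rw [norm_mul, norm_cpow_mul_gauss _ ht, Real.rpow_two, Complex.neg_re]
    refine mul_le_of_le_one_right (by positivity) ?_
    rw [Complex.norm_exp, Real.exp_le_one_iff]
    simp
    positivity

/-- Locally uniform Gaussian decay of `D_ν(x)` as `x → ∞`. -/
theorem eventually_norm_parabolicD_le (n : ℕ) : ∀ ν₀ : ℂ, ν₀.re < n →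
    ∃ C : ℝ, 0 ≤ C ∧ ∀ᶠ ν in 𝓝 ν₀, ∀ x : ℝ, 0 ≤ x →
      ‖parabolicD ν x‖ ≤ C * (1 + x) ^ n * Real.exp (-(1 / 4) * x ^ 2) := by
  -- The integral covers Re ν < 0. Each further unit strip follows from the recurrence to ν - 1 and
  -- ν - 2, at the cost of a factor 1 + x.
  induction n with
  | zero =>
    intro ν₀ hν₀
    rw [Nat.cast_zero] at hν₀
    set K : ℂ → ℝ := fun ν => ‖(Complex.Gamma (-ν))⁻¹‖ *
      ((1 / 2) ^ (ν.re / 2) * (1 / 2) * Real.Gamma (-ν.re / 2)) with hKdef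
    have hG : ContinuousAt Real.Gamma (-ν₀.re / 2) :=
      (Real.differentiableAt_Gamma fun m hm => by
        have : (0 : ℝ) ≤ m := m.cast_nonneg
        linarith).continuousAt
    have hG1 : ContinuousAt (fun ν : ℂ => (Complex.Gamma (-ν))⁻¹) ν₀ :=
      (Complex.differentiable_one_div_Gamma.comp differentiable_neg).continuous.continuousAt
    have hG2 : ContinuousAt (fun ν : ℂ => Real.Gamma (-ν.re / 2)) ν₀ :=
      ContinuousAt.comp (f := fun ν : ℂ => -ν.re / 2) hG (by fun_prop)
    have hG3 : ContinuousAt (fun ν : ℂ => (1 / 2 : ℝ) ^ (ν.re / 2)) ν₀ :=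
      ContinuousAt.rpow continuousAt_const (by fun_prop) (Or.inl (by norm_num))
    have hK : ContinuousAt K ν₀ := hG1.norm.mul ((hG3.mul continuousAt_const).mul hG2)
    refine ⟨|K ν₀| + 1, by positivity, ?_⟩
    filter_upwards [hK.eventually_lt_const (show K ν₀ < |K ν₀| + 1 by
      linarith [le_abs_self (K ν₀)]),
      Complex.continuous_re.continuousAt.eventually_lt_const hν₀] with ν h1 h2 x hx
    rw [pow_zero, mul_one]
    refine (norm_parabolicD_le h2 hx).trans ?_
    gcongr
  | succ n ih =>
    intro ν₀ hν₀
    push_cast at hν₀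
    obtain ⟨C₁, hC₁, h₁⟩ := ih (ν₀ - 1) (by simp; linarith)
    obtain ⟨C₂, hC₂, h₂⟩ := ih (ν₀ - 2) (by simp; linarith)
    refine ⟨C₁ + (‖ν₀ - 1‖ + 1) * C₂, by positivity, ?_⟩
    have t₁ : Filter.Tendsto (fun ν : ℂ => ν - 1) (𝓝 ν₀) (𝓝 (ν₀ - 1)) :=
      (continuous_sub_right 1).tendsto _
    have t₂ : Filter.Tendsto (fun ν : ℂ => ν - 2) (𝓝 ν₀) (𝓝 (ν₀ - 2)) :=
      (continuous_sub_right 2).tendsto _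
    filter_upwards [t₁.eventually h₁, t₂.eventually h₂,
      t₁.norm.eventually_le_const (show ‖ν₀ - 1‖ < ‖ν₀ - 1‖ + 1 by linarith)]
      with ν b₁ b₂ b₃ x hx
    rw [parabolicD_eq]
    calc ‖(x : ℂ) * parabolicD (ν - 1) x - (ν - 1) * parabolicD (ν - 2) x‖
        ≤ ‖(x : ℂ)‖ * ‖parabolicD (ν - 1) x‖ + ‖ν - 1‖ * ‖parabolicD (ν - 2) x‖ := by
          rw [← norm_mul, ← norm_mul]
          exact norm_sub_le _ _
      _ ≤ (1 + x) * (C₁ * (1 + x) ^ n * Real.exp (-(1 / 4) * x ^ 2)) +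
          (‖ν₀ - 1‖ + 1) * ((1 + x) * (C₂ * (1 + x) ^ n * Real.exp (-(1 / 4) * x ^ 2))) := by
          have hx' : ‖(x : ℂ)‖ ≤ 1 + x := by
            rw [Complex.norm_real, Real.norm_of_nonneg hx]
            linarith
          have e₂ := b₂ x hx
          gcongr
          · exact b₁ x hx
          · refine e₂.trans (le_mul_of_one_le_left (by positivity) (by linarith))
      _ = _ := by ring

end Weber

/-! ### Integration by parts on (b, ∞), reality and simplicity of zeros -/

namespace Weber

open MeasureTheory Set ComplexConjugate

theorem one_add_pow_mul_gauss_le (n : ℕ) {x : ℝ} (hx : 0 ≤ x) :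
    (1 + x) ^ n * Real.exp (-(1 / 4) * x ^ 2) ≤ n.factorial * Real.exp 5 * Real.exp (-1 * x) := by
  have h := Real.pow_div_factorial_le_exp (1 + x) (by positivity) n
  rw [div_le_iff₀ (by positivity)] at h
  calc (1 + x) ^ n * Real.exp (-(1 / 4) * x ^ 2)
      ≤ Real.exp (1 + x) * n.factorial * Real.exp (-(1 / 4) * x ^ 2) := by gcongr
    _ = n.factorial * Real.exp (1 + x + -(1 / 4) * x ^ 2) := by rw [Real.exp_add (1 + x)]; ring
    _ ≤ n.factorial * Real.exp (5 + -1 * x) := by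
        refine mul_le_mul_of_nonneg_left (Real.exp_le_exp.2 ?_) (by positivity)
        -- The constant 5 comes from completing the square: 5 - x - (1 + x - x²/4) = (x/2 - 2)².
        nlinarith [sq_nonneg (x / 2 - 2)]
    _ = _ := by rw [Real.exp_add]; ring

/-- Locally uniform exponential decay of `D_ν(x)` as `x → ∞`. -/
theorem eventually_norm_parabolicD_le_exp (ν₀ : ℂ) :
    ∃ C : ℝ, 0 ≤ C ∧ ∀ᶠ ν in 𝓝 ν₀, ∀ x : ℝ, 0 ≤ x →
      ‖parabolicD ν x‖ ≤ C * Real.exp (-1 * x) := by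
  obtain ⟨n, hn⟩ := exists_nat_gt ν₀.re
  obtain ⟨C, hC, h⟩ := eventually_norm_parabolicD_le n ν₀ hn
  refine ⟨C * (n.factorial * Real.exp 5), by positivity, ?_⟩
  filter_upwards [h] with ν hν x hx
  refine (hν x hx).trans ?_
  rw [mul_assoc, mul_assoc C]
  exact mul_le_mul_of_nonneg_left (one_add_pow_mul_gauss_le n hx) hC

theorem norm_parabolicD_le_exp (ν : ℂ) :
    ∃ C : ℝ, 0 ≤ C ∧ ∀ x : ℝ, 0 ≤ x → ‖parabolicD ν x‖ ≤ C * Real.exp (-1 * x) := by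
  obtain ⟨C, hC, h⟩ := eventually_norm_parabolicD_le_exp ν
  exact ⟨C, hC, h.self_of_nhds⟩

theorem continuous_parabolicD (ν : ℂ) : Continuous fun x : ℝ => parabolicD ν x :=
  (continuous_iff_continuousAt.2 fun x => (hasDerivAt_parabolicD ν x).continuousAt).comp
    Complex.continuous_ofReal

theorem norm_parabolicD_mul_le {μ ν : ℂ} {C₁ C₂ x : ℝ} (hC₁ : 0 ≤ C₁) (hC₂ : 0 ≤ C₂) (hx : 0 ≤ x)
    (h₁ : ‖parabolicD μ x‖ ≤ C₁ * Real.exp (-1 * x))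
    (h₂ : ‖parabolicD ν x‖ ≤ C₂ * Real.exp (-1 * x)) :
    ‖parabolicD μ x * parabolicD ν x‖ ≤ C₁ * C₂ * Real.exp (-1 * x) := by
  have he : Real.exp (-1 * x) ≤ 1 := Real.exp_le_one_iff.2 (by linarith)
  rw [norm_mul]
  calc _ ≤ C₁ * Real.exp (-1 * x) * (C₂ * 1) := by gcongr; exact h₂.trans (by gcongr)
    _ = _ := by ring

theorem exists_norm_parabolicD_mul_le (μ ν : ℂ) :
    ∃ C : ℝ, ∀ x : ℝ, 0 ≤ x →
      ‖parabolicD μ x * parabolicD ν x‖ ≤ C * Real.exp (-1 * x) := by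
  obtain ⟨C₁, hC₁, h₁⟩ := norm_parabolicD_le_exp μ
  obtain ⟨C₂, hC₂, h₂⟩ := norm_parabolicD_le_exp ν
  exact ⟨C₁ * C₂, fun x hx => norm_parabolicD_mul_le hC₁ hC₂ hx (h₁ x hx) (h₂ x hx)⟩

theorem integrableOn_parabolicD_mul (μ ν : ℂ) {b : ℝ} (hb : 0 ≤ b) :
    IntegrableOn (fun x : ℝ => parabolicD μ x * parabolicD ν x) (Ioi b) := by
  obtain ⟨C, h⟩ := exists_norm_parabolicD_mul_le μ ν
  refine Integrable.mono' ((integrableOn_exp_mul_Ioi (a := -1) (by norm_num) b).const_mul C)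
    ((continuous_parabolicD μ).mul (continuous_parabolicD ν)).aestronglyMeasurable
    ((ae_restrict_iff' measurableSet_Ioi).2 (Filter.Eventually.of_forall fun x hx => ?_))
  exact h x (hb.trans (le_of_lt hx))

theorem tendsto_parabolicD_mul (μ ν : ℂ) :
    Filter.Tendsto (fun x : ℝ => parabolicD μ x * parabolicD ν x) Filter.atTop (𝓝 0) := by
  obtain ⟨C, h⟩ := exists_norm_parabolicD_mul_le μ ν
  have hlim : Filter.Tendsto (fun x : ℝ => C * Real.exp (-1 * x)) Filter.atTop (𝓝 0) := by
    simpa using Real.tendsto_exp_neg_atTop_nhds_zero.const_mul C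
  exact squeeze_zero_norm' ((Filter.eventually_ge_atTop 0).mono h) hlim

/-- The bilinear pairing `∫_b^∞ D_μ D_ν`. -/
noncomputable def pairing (b : ℝ) (μ ν : ℂ) : ℂ :=
  ∫ x in Ioi b, parabolicD μ (x : ℝ) * parabolicD ν (x : ℝ)

theorem pairing_comm (b : ℝ) (μ ν : ℂ) : pairing b μ ν = pairing b ν μ := by
  simp only [pairing, mul_comm]

/-- Integration by parts: the raising and lowering operators are adjoint up to a boundary term. -/
theorem mul_pairing_sub_pairing (μ ν : ℂ) {b : ℝ} (hb : 0 ≤ b) :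
    μ * pairing b (μ - 1) ν - pairing b μ (ν + 1) = -(parabolicD μ b * parabolicD ν b) := by
  have h1 := (integrableOn_parabolicD_mul (μ - 1) ν hb).const_mul μ
  have h2 := integrableOn_parabolicD_mul μ (ν + 1) hb
  rw [pairing, pairing, ← integral_const_mul, ← integral_sub h1 h2, ← zero_sub]
  refine integral_Ioi_of_hasDerivAt_of_tendsto' (fun x _ => ?_) (h1.sub h2)
    (tendsto_parabolicD_mul μ ν)
  refine ((hasDerivAt_parabolicD μ x).comp_ofReal.mul
    (hasDerivAt_parabolicD' ν x).comp_ofReal).congr_deriv ?_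
  simp only [Pi.sub_apply]
  ring

/-- The Wronskian identity for two parameters. -/
theorem sub_mul_pairing (μ ν : ℂ) {b : ℝ} (hb : 0 ≤ b) :
    (μ - ν) * pairing b μ ν =
      parabolicD (ν + 1) b * parabolicD μ b - parabolicD (μ + 1) b * parabolicD ν b := by
  have h1 := mul_pairing_sub_pairing (μ + 1) ν hb
  have h2 := mul_pairing_sub_pairing (ν + 1) μ hb
  rw [add_sub_cancel_right] at h1 h2
  rw [pairing_comm b ν μ, pairing_comm b (ν + 1)] at h2
  linear_combination h1 - h2

/-- The squared `L²` norm of `D_ν` on `(b, ∞)`. -/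
noncomputable def normSqD (b : ℝ) (ν : ℂ) : ℝ := ∫ x in Ioi b, ‖parabolicD ν (x : ℝ)‖ ^ 2

theorem normSqD_nonneg (b : ℝ) (ν : ℂ) : 0 ≤ normSqD b ν :=
  integral_nonneg fun _ => by positivity

theorem conj_mul_parabolicD (ν : ℂ) (x : ℝ) :
    parabolicD (conj ν) x * parabolicD ν x = ((‖parabolicD ν x‖ ^ 2 : ℝ) : ℂ) := by
  have := conj_parabolicD ν x
  rw [Complex.conj_ofReal] at this
  rw [← this, Complex.conj_mul']
  push_cast
  rfl

theorem pairing_conj (b : ℝ) (ν : ℂ) : pairing b (conj ν) ν = normSqD b ν := by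
  rw [pairing, normSqD, ← integral_complex_ofReal]
  exact integral_congr_ae (Filter.Eventually.of_forall fun x => conj_mul_parabolicD ν x)

theorem normSqD_pos {b : ℝ} (hb : 0 ≤ b) {ν : ℂ} (h : parabolicD ν b ≠ 0) : 0 < normSqD b ν := by
  have hc : Continuous fun x : ℝ => ‖parabolicD ν x‖ ^ 2 := (continuous_parabolicD ν).norm.pow 2
  have hi : IntegrableOn (fun x : ℝ => ‖parabolicD ν x‖ ^ 2) (Ioi b) := by
    refine (integrableOn_parabolicD_mul (conj ν) ν hb).norm.congr
      (Filter.Eventually.of_forall fun x => ?_)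
    dsimp only
    rw [conj_mul_parabolicD, Complex.norm_real, Real.norm_of_nonneg (by positivity)]
  rw [normSqD, setIntegral_pos_iff_support_of_nonneg_ae
    (Filter.Eventually.of_forall fun x => by positivity) hi]
  have ho : IsOpen (Function.support (fun x : ℝ => ‖parabolicD ν x‖ ^ 2) ∩ Ioi b) :=
    hc.isOpen_support.inter isOpen_Ioi
  refine ho.measure_pos volume ?_
  have hm : Function.support (fun x : ℝ => ‖parabolicD ν x‖ ^ 2) ∈ 𝓝[>] b :=
    mem_nhdsWithin_of_mem_nhds (hc.isOpen_support.mem_nhds (by simpa using h))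
  exact Filter.nonempty_of_mem (Filter.inter_mem hm self_mem_nhdsWithin)

theorem continuousAt_pairing (b : ℝ) (hb : 0 ≤ b) (μ ν₀ : ℂ) :
    ContinuousAt (fun ν => pairing b μ ν) ν₀ := by
  obtain ⟨C₁, hC₁, h₁⟩ := norm_parabolicD_le_exp μ
  obtain ⟨C₂, hC₂, h₂⟩ := eventually_norm_parabolicD_le_exp ν₀
  refine tendsto_integral_filter_of_dominated_convergence
    (fun x => C₁ * C₂ * Real.exp (-1 * x)) (Filter.Eventually.of_forall fun ν =>
      ((continuous_parabolicD μ).mul (continuous_parabolicD ν)).aestronglyMeasurable) ?_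
    ((integrableOn_exp_mul_Ioi (a := -1) (by norm_num) b).const_mul _)
    (Filter.Eventually.of_forall fun x =>
      ((differentiable_parabolicD x).continuous.const_mul _).tendsto ν₀)
  filter_upwards [h₂] with ν hν
  refine (ae_restrict_iff' measurableSet_Ioi).2 (Filter.Eventually.of_forall fun x hx => ?_)
  have hx : 0 ≤ x := hb.trans (le_of_lt hx)
  exact norm_parabolicD_mul_le hC₁ hC₂ hx (h₁ x hx) (hν x hx)

/-- D at conj l also vanishes at b, by conjugation, so the adjointness identity for conj l and l - 1
has no boundary term. -/
theorem normSqD_eq_of_parabolicD_eq_zero {b : ℝ} (hb : 0 ≤ b) {l : ℂ} (h : parabolicD l b = 0) :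
    conj l * normSqD b (l - 1) = normSqD b l := by
  have h1 := mul_pairing_sub_pairing (conj l) (l - 1) hb
  have h2 := conj_parabolicD l b
  rw [h, map_zero, Complex.conj_ofReal] at h2
  rw [← h2, sub_add_cancel, zero_mul, neg_zero, pairing_conj,
    show conj l - 1 = conj (l - 1) by simp, pairing_conj] at h1
  exact sub_eq_zero.1 h1

theorem im_eq_zero_and_re_pos_of_parabolicD_eq_zero {b : ℝ} (hb : 0 ≤ b) {l : ℂ} (h : parabolicD l b = 0) :
    l.im = 0 ∧ 0 < l.re := by
  have h0 := mul_parabolicD_sub_one_ne_zero l b h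
  have hp := normSqD_pos hb (right_ne_zero_of_mul h0)
  have he := normSqD_eq_of_parabolicD_eq_zero hb h
  have hre := congrArg Complex.re he
  have him := congrArg Complex.im he
  simp only [Complex.re_mul_ofReal, Complex.im_mul_ofReal, Complex.conj_re, Complex.conj_im,
    Complex.ofReal_re, Complex.ofReal_im, mul_eq_zero, neg_eq_zero, hp.ne', or_false] at hre him
  refine ⟨him, lt_of_le_of_ne ?_ fun hz => left_ne_zero_of_mul h0 (Complex.ext hz.symm him)⟩
  exact nonneg_of_mul_nonneg_left (hre ▸ normSqD_nonneg b l) hp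

/-- `normSqD_pos` does not apply at l, where D vanishes at b; positivity is transferred from l - 1.
-/
theorem normSqD_pos_of_parabolicD_eq_zero {b : ℝ} (hb : 0 ≤ b) {l : ℂ} (h : parabolicD l b = 0) :
    0 < normSqD b l := by
  have hp := normSqD_pos hb (right_ne_zero_of_mul (mul_parabolicD_sub_one_ne_zero l b h))
  have hre := congrArg Complex.re (normSqD_eq_of_parabolicD_eq_zero hb h)
  rw [Complex.re_mul_ofReal, Complex.conj_re, Complex.ofReal_re] at hre
  exact hre ▸ mul_pos (im_eq_zero_and_re_pos_of_parabolicD_eq_zero hb h).2 hp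

/-- The derivative of `ν ↦ D_ν(b)` at a real zero `l` is `∫_b^∞ D_l² / D_{l+1}(b)`. -/
theorem parabolicD_add_one_mul_deriv {b : ℝ} (hb : 0 ≤ b) {l : ℝ} (h : parabolicD l b = 0) :
    parabolicD (l + 1) b * deriv (fun ν => parabolicD ν b) l = normSqD b l := by
  have hd := ((differentiable_parabolicD b) l).hasDerivAt.tendsto_slope.const_mul
    (parabolicD (l + 1) b)
  have hc : Filter.Tendsto (fun ν => pairing b l ν) (𝓝[≠] (l : ℂ)) (𝓝 (pairing b l l)) :=
    (continuousAt_pairing b hb l l).mono_left nhdsWithin_le_nhds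
  have hn : pairing b l l = normSqD b l := by
    simpa using pairing_conj b l
  rw [← hn]
  -- For ν ≠ l the Wronskian identity says that D_{l+1}(b) times the difference quotient equals the
  -- pairing of D_l with D_ν.
  refine tendsto_nhds_unique (hd.congr' ?_) hc
  filter_upwards [self_mem_nhdsWithin] with ν hν
  have hν' : ν - l ≠ 0 := sub_ne_zero.2 hν
  have := sub_mul_pairing l ν hb
  rw [slope_def_field, h, sub_zero, mul_div_assoc', div_eq_iff hν']
  rw [h] at this
  linear_combination this

/-! ### Sign and local expansion of M at a zero -/

/-- D_l(x) = 0 expresses y_even Γ(-l/2) through y_odd Γ(-l/2 + 1/2), and duplication splits Γ(-l)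
into these two Gammas. The resulting square is what makes c₂ positive. -/
theorem Gamma_mul_yEven_mul_yOdd {l : ℂ} {x : ℂ} (h : parabolicD l x = 0)
    (h0 : Complex.Gamma (-l / 2) ≠ 0) (h1 : Complex.Gamma (-l / 2 + 1 / 2) ≠ 0) :
    Complex.Gamma (-l) * yEven l x * yOdd l x =
      2 ^ (-l - 1 / 2) / Real.sqrt Real.pi * (Complex.Gamma (-l / 2 + 1 / 2) * yOdd l x) ^ 2 := by
  have hpi : (Real.sqrt Real.pi : ℂ) ≠ 0 := by
    exact_mod_cast (Real.sqrt_pos.2 Real.pi_pos).ne'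
  have h2 : ∀ z : ℂ, (2 : ℂ) ^ z ≠ 0 := fun z => by simp [Complex.cpow_eq_zero_iff]
  have hd := Complex.Gamma_mul_Gamma_add_half (-l / 2)
  rw [show 2 * (-l / 2) = -l by ring] at hd
  have e1 : (2 : ℂ) ^ ((l + 1) / 2) = 2 ^ (l / 2) * 2 ^ (1 / 2 : ℂ) := by
    rw [← Complex.cpow_add _ _ two_ne_zero]
    congr 1
    ring
  have e2 : (2 : ℂ) ^ (1 / 2 : ℂ) = 2 ^ (-l - 1 / 2) * 2 ^ (1 - -l) := by
    rw [← Complex.cpow_add _ _ two_ne_zero]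
    congr 1
    ring
  rw [parabolicD, dValue, dSlope, e1] at h
  -- The equation D_l(x) = 0 with its Gamma denominators cleared.
  have key : yEven l x * Complex.Gamma (-l / 2) =
      2 ^ (1 / 2 : ℂ) * Complex.Gamma (-l / 2 + 1 / 2) * yOdd l x := by
    have i0 := mul_inv_cancel₀ h0
    have i1 := mul_inv_cancel₀ h1
    refine mul_left_cancel₀ (mul_ne_zero (h2 (l / 2)) hpi) ?_
    generalize Complex.Gamma (-l / 2) = g₀ at *
    generalize Complex.Gamma (-l / 2 + 1 / 2) = g₁ at *
    linear_combination g₀ * g₁ * h - 2 ^ (l / 2) * Real.sqrt Real.pi * yEven l x * g₀ * i1 +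
      2 ^ (l / 2) * Real.sqrt Real.pi * 2 ^ (1 / 2 : ℂ) * yOdd l x * g₁ * i0
  have h4 := h2 (1 - -l)
  rw [div_mul_eq_mul_div, eq_div_iff hpi]
  refine mul_right_cancel₀ (mul_ne_zero h4 h0) ?_
  rw [e2] at key
  linear_combination (-(yEven l x * yOdd l x * Complex.Gamma (-l / 2))) * hd +
    (Complex.Gamma (-l / 2) * Complex.Gamma (-l / 2 + 1 / 2) * yOdd l x) * key

/-- Poles of the three Gammas occur only at l = 0, 1, 2, …, and l > 0 excludes 0. As Mathlib's
`Gamma` is 0 at its poles, nonvanishing here means the absence of a pole. -/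
theorem Gamma_ne_zero_of_parabolicD_eq_zero {b : ℝ} (hb : 0 ≤ b) {l : ℝ} (hl : ∀ n : ℕ, 0 < n → l ≠ (n : ℝ))
    (h : parabolicD l b = 0) :
    Complex.Gamma (-l) ≠ 0 ∧ Complex.Gamma (-l / 2) ≠ 0 ∧ Complex.Gamma (-l / 2 + 1 / 2) ≠ 0 := by
  have hpos : 0 < l := by simpa using (im_eq_zero_and_re_pos_of_parabolicD_eq_zero hb h).2
  have hn : ∀ n : ℕ, (l : ℂ) ≠ n := fun n hn => by
    have hn : l = n := by exact_mod_cast hn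
    rcases Nat.eq_zero_or_pos n with rfl | h0
    · simp [hn] at hpos
    · exact hl n h0 hn
  refine ⟨Complex.Gamma_ne_zero fun m hm => hn m ?_, Complex.Gamma_ne_zero fun m hm =>
    hn (2 * m) ?_, Complex.Gamma_ne_zero fun m hm => hn (2 * m + 1) ?_⟩
  · linear_combination -hm
  · push_cast
    linear_combination -2 * hm
  · push_cast
    linear_combination -2 * hm

theorem analyticAt_sqrt_mul_Gamma_mul_yEven_mul_yOdd {b : ℝ} {l : ℂ} (h : Complex.Gamma (-l) ≠ 0) :
    AnalyticAt ℂ (fun ν : ℂ => (Real.sqrt (2 / Real.pi) : ℂ) * Complex.Gamma (-ν)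
      * yEven ν (b : ℂ) * yOdd ν (b : ℂ)) l := by
  have hG : AnalyticAt ℂ (fun ν : ℂ => Complex.Gamma (-ν)) l := by
    have h1 : AnalyticAt ℂ (fun ν : ℂ => (Complex.Gamma (-ν))⁻¹) l :=
      (Complex.differentiable_one_div_Gamma.comp differentiable_neg).analyticAt l
    simpa using h1.fun_inv (inv_ne_zero h)
  exact ((analyticAt_const.mul hG).mul ((differentiable_yEven b).analyticAt l)).mul
    ((differentiable_yOdd b).analyticAt l)

/-- If `f` vanishes at `l` with derivative `d`, then `k f²` has the expansion
`k(l) d² (ν - l)² + O((ν - l)³)`. -/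
theorem isBigO_mul_sq_sub {f k : ℂ → ℂ} {l : ℂ} (hf : AnalyticAt ℂ f l) (hk : AnalyticAt ℂ k l)
    (h0 : f l = 0) :
    (fun ν => k ν * f ν ^ 2 - k l * deriv f l ^ 2 * (ν - l) ^ 2) =O[𝓝 l] fun ν => (ν - l) ^ 3 := by
  -- Factor f = (ν - l) g with g analytic, so that g(l) = f'(l); then k g² differs from its value at
  -- l by O(ν - l).
  obtain ⟨g, hg, hfg⟩ := (natCast_le_analyticOrderAt hf (n := 1)).1 (by
    rw [Nat.cast_one, Order.one_le_iff_ne_zero]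
    exact hf.analyticOrderAt_ne_zero.2 h0)
  have hd : deriv f l = g l := by
    have h1 : HasDerivAt (fun z => (z - l) * g z) (1 * g l + (l - l) * deriv g l) l :=
      ((hasDerivAt_id l).sub_const l).mul hg.differentiableAt.hasDerivAt
    have h2 : f =ᶠ[𝓝 l] fun z => (z - l) * g z := hfg.mono fun z hz => by simpa using hz
    rw [h2.deriv_eq, h1.deriv]
    simp
  have hO : (fun ν => k ν * g ν ^ 2 - k l * g l ^ 2) =O[𝓝 l] fun ν => ν - l :=
    (hk.mul (hg.pow 2)).differentiableAt.isBigO_sub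
  refine ((isBigO_refl (fun ν => (ν - l) ^ 2) (𝓝 l)).mul hO).congr' ?_ ?_
  · filter_upwards [hfg] with ν hν
    rw [hν, hd, pow_one, smul_eq_mul]
    ring
  · exact Filter.Eventually.of_forall fun ν => by ring

end Weber

theorem mainTheorem6 (b : ℝ) (hb : 0 < b) :
    (∀ l : ℂ, Weber.parabolicD l (b : ℂ) = 0 → l.im = 0 ∧ 0 < l.re) ∧
    (∀ l : ℝ, (∀ n : ℕ, 0 < n → l ≠ (n : ℝ)) → Weber.parabolicD (l : ℂ) (b : ℂ) = 0 →
      analyticOrderAt (fun ν : ℂ => Weber.parabolicD ν (b : ℂ)) (l : ℂ) = 1) ∧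
    (∀ l : ℝ, (∀ n : ℕ, 0 < n → l ≠ (n : ℝ)) → Weber.parabolicD (l : ℂ) (b : ℂ) = 0 →
      AnalyticAt ℂ (Weber.eigM b) (l : ℂ) ∧
      ∃ c₂ : ℝ, 0 < c₂ ∧
        (fun ν : ℂ => Weber.eigM b ν - (c₂ : ℂ) * (ν - (l : ℂ)) ^ 2)
          =O[𝓝 (l : ℂ)] fun ν : ℂ => (ν - (l : ℂ)) ^ 3) := by
  have hD := fun l : ℂ => (Weber.differentiable_parabolicD b).analyticAt l
  have hderiv : ∀ l : ℝ, Weber.parabolicD (l : ℂ) (b : ℂ) = 0 →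
      ∃ d : ℝ, d ≠ 0 ∧ deriv (fun ν : ℂ => Weber.parabolicD ν (b : ℂ)) l = d := by
    intro l h
    have h1 := Weber.parabolicD_add_one_mul_deriv hb.le h
    have h2 := Weber.normSqD_pos_of_parabolicD_eq_zero hb.le h
    have h3 := Weber.ofReal_re_parabolicD (l + 1) b
    rw [Complex.ofReal_add, Complex.ofReal_one] at h3
    set r := (Weber.parabolicD (l + 1) b).re
    have hr : r ≠ 0 := fun hr => by
      rw [← h3, hr, Complex.ofReal_zero, zero_mul] at h1
      exact h2.ne (by exact_mod_cast h1)
    -- The derivative is real because D_{l+1}(b) is real for real l.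
    refine ⟨Weber.normSqD b l / r, div_ne_zero h2.ne' hr, ?_⟩
    rw [Complex.ofReal_div, eq_div_iff (by exact_mod_cast hr), ← h1, ← h3, mul_comm]
  refine ⟨fun l h => Weber.im_eq_zero_and_re_pos_of_parabolicD_eq_zero hb.le h, fun l _ h => ?_, fun l hl h => ?_⟩
  · obtain ⟨d, hd, hd'⟩ := hderiv l h
    exact (hD l).analyticOrderAt_eq_one_of_zero_deriv_ne_zero h
      (by rw [hd']; exact_mod_cast hd)
  · obtain ⟨d, hd, hd'⟩ := hderiv l h
    obtain ⟨hG, hG0, hG1⟩ := Weber.Gamma_ne_zero_of_parabolicD_eq_zero hb.le hl h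
    have hk := Weber.analyticAt_sqrt_mul_Gamma_mul_yEven_mul_yOdd (b := b) hG
    have hM : Weber.eigM b = fun ν : ℂ => (Real.sqrt (2 / Real.pi) * Complex.Gamma (-ν)
        * Weber.yEven ν (b : ℂ) * Weber.yOdd ν (b : ℂ)) * Weber.parabolicD ν (b : ℂ) ^ 2 := by
      funext ν
      rw [Weber.eigM]
      ring
    have hO := Weber.isBigO_mul_sq_sub (hD l) hk h
    -- If y_odd(b) were 0, then D_l(b) = 0 with D_l(0) ≠ 0 would force y_even(b) = 0, against the
    -- Wronskian.
    have hy : Weber.yOdd l b ≠ 0 := fun hy => by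
      have hval : Weber.dValue l ≠ 0 := by
        have h2 : (2 : ℂ) ^ ((l : ℂ) / 2) ≠ 0 := by simp [Complex.cpow_eq_zero_iff]
        have hpi : (Real.sqrt Real.pi : ℂ) ≠ 0 := by
          exact_mod_cast (Real.sqrt_pos.2 Real.pi_pos).ne'
        exact mul_ne_zero (mul_ne_zero h2 hpi) (inv_ne_zero hG1)
      refine Weber.yOdd_ne_zero_of_yEven_eq_zero l b ?_ hy
      simpa [Weber.parabolicD, hy, hval] using h
    -- The witness is k(l) d², where M = k D², with k(l) rewritten by `Gamma_mul_yEven_mul_yOdd` in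
    -- real quantities so that its sign is visible.
    refine ⟨hM ▸ hk.mul ((hD l).pow 2), Real.sqrt (2 / Real.pi) *
      (2 ^ (-l - 1 / 2) / Real.sqrt Real.pi *
        (Real.Gamma (-l / 2 + 1 / 2) * (Weber.yOdd l b).re) ^ 2) * d ^ 2, ?_, ?_⟩
    · have h1 : Real.Gamma (-l / 2 + 1 / 2) ≠ 0 := fun h1 => hG1 (by
        rw [show (-l / 2 + 1 / 2 : ℂ) = ((-l / 2 + 1 / 2 : ℝ) : ℂ) by push_cast; ring,
          Complex.Gamma_ofReal, h1, Complex.ofReal_zero])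
      have h2 : (Weber.yOdd l b).re ≠ 0 := fun h2 => hy (by
        rw [← Weber.ofReal_re_yOdd, h2, Complex.ofReal_zero])
      have hpi := Real.pi_pos
      positivity
    · have hc : (Real.sqrt (2 / Real.pi) : ℂ) * Complex.Gamma (-l) * Weber.yEven l b *
          Weber.yOdd l b * d ^ 2 = ((Real.sqrt (2 / Real.pi) *
            (2 ^ (-l - 1 / 2) / Real.sqrt Real.pi *
            (Real.Gamma (-l / 2 + 1 / 2) * (Weber.yOdd l b).re) ^ 2) * d ^ 2 : ℝ) : ℂ) := by
        have h3 := Weber.Gamma_mul_yEven_mul_yOdd h hG0 hG1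
        have h4 : ((2 ^ (-l - 1 / 2) : ℝ) : ℂ) = 2 ^ (-l - 1 / 2 : ℂ) := by
          rw [Complex.ofReal_cpow zero_le_two]
          push_cast
          rfl
        push_cast [← Complex.Gamma_ofReal, Weber.ofReal_re_yOdd, h4]
        linear_combination (Real.sqrt (2 / Real.pi) : ℂ) * d ^ 2 * h3
      rw [hd', hc] at hO
      rw [hM]
      exact hO
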